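/- A realtime alternating one-counter automaton (A1CA) over an input alphabet $\Sigma$ consists of a finite set $S$ of states, each of which is either existential or universal, an initial state $s_1\in S$, an accepting state $s_a\in S$, and a transition function $\delta: S\times(\Sigma\cup\{\#\})\times\{0,\pm\}\to\mathcal P(S\times\{-1,0,1\})$, where $\#\notin\Sigma$ is an end-marker. On input $w\in\Sigma^*$ the automaton reads $\#w\#$ from left to right and spends exactly two steps on each symbol, starting in state $s_1$ with its integer counter equal to $0$. In a step in state $s$ on symbol $\sigma$, with $\theta=0$ if the counter is zero and $\theta=\pm$ if it is nonzero, it branches to all $(s',d)\in\delta(s,\sigma,\theta)$, where $s'$ is the next state and $d$ is added to the counter. In the resulting computation tree, a leaf is true if it is reached after the last step and its state is $s_a$, and false otherwise (in particular, a node with no possible move before the last step is a false leaf). An inner node is true if at least one of its children is true (existential state), respectively if all of its children are true (universal state). The input is accepted if and only if the root is true. Theorem. The emptiness problem for A1CAs over a unary alphabet $\Sigma=\{u\}$ is undecidable: there is no algorithm that, given a finite description of such an automaton (its states, its universal states, its initial and accepting states, and the list of its transitions), decides whether the automaton accepts no word $u^n$, $n\ge 0$. -/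

import Mathlib

/-- A realtime alternating one-counter automaton with input alphabet `σ` and finite state set `S`.
A tape symbol is an element of `Option σ`: `some a` is an input letter, `none` is the end-marker.
`δ s x z` is the set of possible moves (next state, counter update in `{-1, 0, 1}`) in state `s` on
tape symbol `x`, where `z` is `true` if the counter value is zero and `false` if it is nonzero.
States that are not universal are existential. -/
structure A1CA (σ S : Type*) [Finite S] where
  isUniversal : S → Prop
  δ : S → Option σ → Bool → Set (S × SignType)
  initial : S
  accepting : S

namespace A1CA

variable {σ S : Type*} [Finite S]

/-- The tape symbols scanned in the successive steps on input `w`: the tape is `w` between two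
end-markers, and exactly two steps are spent on each of its symbols. -/
def schedule (w : List σ) : List (Option σ) :=
  (none :: (w.map some ++ [none])).flatMap fun x => [x, x]

/-- The truth value of the node (state `s`, counter value `c`) of the computation tree when the
symbols to be scanned in the remaining steps are those of the given list. When no step remains, the
node is an accepting leaf iff its state is the accepting one. A node without a possible move while
steps remain is a leaf that does not accept, whether its state is existential or universal. -/
def value (A : A1CA σ S) : List (Option σ) → S → ℤ → Prop
  | [], s, _ => s = A.accepting
  | x :: xs, s, c =>
    (A.isUniversal s ∧ (A.δ s x (decide (c = 0))).Nonempty ∧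
      ∀ p ∈ A.δ s x (decide (c = 0)), A.value xs p.1 (c + (p.2 : ℤ))) ∨
    (¬ A.isUniversal s ∧
      ∃ p ∈ A.δ s x (decide (c = 0)), A.value xs p.1 (c + (p.2 : ℤ)))

/-- The language of the automaton; the counter starts at `0`. -/
def language (A : A1CA σ S) : Language σ :=
  {w | A.value (schedule w) A.initial 0}

end A1CA

instance : Primcodable SignType :=
  Primcodable.ofEquiv (Fin 3) SignType.fin3Equiv.toEquiv

/-- A finite description of a unary A1CA, the form in which an automaton is given to an algorithm.
States are named by natural numbers. A transition `((s, x, z), (t, k))` says `(t, k) ∈ δ(s, x, z)`.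
The universal states are listed; all other states are existential. -/
structure UnaryA1CACode where
  states : List ℕ
  universal : List ℕ
  transitions : List ((ℕ × Option Unit × Bool) × (ℕ × SignType))
  initial : ℕ
  accepting : ℕ

namespace UnaryA1CACode

/-- A description as the tuple of its components. -/
def equivTuple : UnaryA1CACode ≃
    List ℕ × List ℕ × List ((ℕ × Option Unit × Bool) × (ℕ × SignType)) × ℕ × ℕ where
  toFun d := (d.states, d.universal, d.transitions, d.initial, d.accepting)
  invFun t := ⟨t.1, t.2.1, t.2.2.1, t.2.2.2.1, t.2.2.2.2⟩
  left_inv _ := rfl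
  right_inv _ := rfl

instance : Primcodable UnaryA1CACode := Primcodable.ofEquiv _ equivTuple

/-- The finite state set of the described automaton: the names in the list `states` together with
all names that occur elsewhere in the description. Thus every description is meaningful. -/
def stateSet (d : UnaryA1CACode) : Finset ℕ :=
  (d.initial :: d.accepting :: (d.states ++ d.universal ++
    d.transitions.flatMap fun r => [r.1.1, r.2.1])).toFinset

/-- The automaton over the one-letter alphabet `Unit` with the given description. -/
def toA1CA (d : UnaryA1CACode) : A1CA Unit d.stateSet where
  isUniversal s := s.1 ∈ d.universal
  δ s x z := {p | ((s.1, x, z), (p.1.1, p.2)) ∈ d.transitions}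
  initial := ⟨d.initial, by simp [stateSet]⟩
  accepting := ⟨d.accepting, by simp [stateSet]⟩

end UnaryA1CACode

/-!
An A1CA can evaluate a cellular automaton backwards in time. Its counter holds the position of a
cell and its state a claim about this cell. On the first of the two steps spent on a letter it
guesses the states of the neighbourhood one time step earlier, and on the second it branches
universally to the three cells, moving the counter by at most one. The last end-marker only allows a
test of the counter for zero, so the initial configuration must be blank outside cell `0`. With a
claim about cell `0` at the start, the word of length `n` is accepted iff cell `0` has a given state
after `n` steps, and the language is nonempty iff this ever happens.

A cellular automaton simulates a fixed Turing machine with an undecidable halting problem. It first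
unpacks the binary numeral of the input from the single nonblank cell, and when the machine halts, a
signal spreads over all cells and reaches cell `0`.
-/

open Turing

/-! ### Turing machines on binary numerals -/

theorem trNum_cond_bit (b : Bool) (m : Num) (h : m = 0 → b = true) :
    PartrecToTM2.trNum (cond b Num.bit1 Num.bit0 m) =
      cond b .bit1 .bit0 :: PartrecToTM2.trNum m := by
  rcases b, m with ⟨_ | _, _ | p⟩
  · exact absurd (h rfl) Bool.false_ne_true
  all_goals rfl

theorem trNat_eq_map_bits (n : ℕ) :
    PartrecToTM2.trNat n = n.bits.map fun b => cond b .bit1 .bit0 := by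
  induction n using Nat.binaryRec' with
  | zero => simp
  | bit b n h ih =>
    have h' : (n : Num) = 0 → b = true := fun h0 =>
      h (by simpa only [Num.to_of_nat, Num.cast_zero] using congrArg ((↑) : Num → ℕ) h0)
    rw [Nat.bits_append_bit n b h, List.map_cons, ← ih, PartrecToTM2.trNat, ← Num.ofNat'_eq,
      Num.ofNat'_bit, Num.ofNat'_eq, trNum_cond_bit b _ h', PartrecToTM2.trNat]

theorem exists_finite_machine_of_supports.{u, v} {Γ : Type u} {Λ : Type v} [Inhabited Γ]
    [Inhabited Λ] {M : TM0.Machine Γ Λ} {S : Finset Λ} (hS : TM0.Supports M S) :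
    ∃ (Λ' : Type v) (_ : Inhabited Λ') (_ : Finite Λ') (M' : TM0.Machine Γ Λ'), ∀ l,
      (TM0.eval M' l).Dom ↔ (TM0.eval M l).Dom := by
  classical
  let : Inhabited S := ⟨⟨default, hS.1⟩⟩
  let restrict : PointedMap Λ S :=
    ⟨fun q => if h : q ∈ S then ⟨q, h⟩ else default, dif_pos hS.1⟩
  have restrict_val : ∀ q ∈ (S : Set Λ), (restrict q : Λ) = q := fun q hq =>
    congrArg Subtype.val (dif_pos hq)
  refine ⟨S, inferInstance, inferInstance,
    M.map (PointedMap.mk id rfl) (PointedMap.mk id rfl) restrict Subtype.val, fun l => ?_⟩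
  refine StateTransition.tr_eval_dom
    (M.map_respects _ _ restrict Subtype.val hS (fun _ => rfl) restrict_val) ⟨hS.1, ?_⟩
  rw [TM0.map_init]
  exact congrArg _ (List.map_id l)

instance : Fintype PartrecToTM2.K' :=
  ⟨{.main, .rev, .aux, .stack}, fun k => by cases k <;> simp⟩

/-- The word `a dₖ ⋯ d₁ d₀`, where `dₖ ⋯ d₁ d₀` is the binary numeral of a number, written with
the digits `digit false` and `digit true`; the number `0` has the empty numeral. -/
def binaryWord {Γ : Type*} (a : Γ) (digit : Bool → Γ) (n : ℕ) : List Γ :=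
  a :: (n.bits.map digit).reverse

/-- A letter of the one-tape machine that simulates `PartrecToTM2.tr`, with a symbol of the main
stack only; `bottom` marks the bottom of the stacks. -/
def mainStackLetter (bottom : Bool) (x : PartrecToTM2.Γ') :
    TM2to1.Γ' PartrecToTM2.K' fun _ => PartrecToTM2.Γ' :=
  (bottom, Function.update (fun _ => none) .main (some x))

/-- The digits with which numbers are written on the tape of the one-tape machine that simulates
`PartrecToTM2.tr`. -/
def mainStackDigit (b : Bool) : TM2to1.Γ' PartrecToTM2.K' fun _ => PartrecToTM2.Γ' :=
  mainStackLetter false (cond b .bit1 .bit0)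

theorem trInit_trList_singleton (n : ℕ) :
    TM2to1.trInit (Γ := fun _ => PartrecToTM2.Γ') .main (PartrecToTM2.trList [n]) =
      binaryWord (mainStackLetter true .cons) mainStackDigit n := by
  have reverse_trList : (PartrecToTM2.trList [n]).reverse =
      .cons :: (n.bits.map fun b => cond b .bit1 .bit0).reverse := by
    simp [PartrecToTM2.trList, trNat_eq_map_bits]
  rw [TM2to1.trInit, reverse_trList, binaryWord, ← List.map_reverse, ← List.map_reverse]
  exact congrArg (mainStackLetter true .cons :: ·) List.map_map

theorem init_main_eq (c : ToPartrec.Code) (v : List ℕ) :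
    letI : Inhabited PartrecToTM2.Λ' := ⟨PartrecToTM2.trNormal c .halt⟩
    TM2.init .main (PartrecToTM2.trList v) = PartrecToTM2.init c v := by
  simp only [TM2.init, PartrecToTM2.init]
  congr 1
  funext k
  cases k <;> rfl

theorem exists_turingMachine_of_partrec {f : ℕ →. ℕ} (hf : Partrec f) :
    ∃ (Γ Λ : Type) (_ : Inhabited Γ) (_ : Inhabited Λ) (_ : Finite Γ) (_ : Finite Λ)
      (M : TM0.Machine Γ Λ) (a : Γ) (digit : Bool → Γ), ∀ n,
      (TM0.eval M (binaryWord a digit n)).Dom ↔ (f n).Dom := by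
  obtain ⟨c, hc⟩ := ToPartrec.Code.exists_code (Nat.Partrec'.part_iff₁.2 hf)
  let : Inhabited PartrecToTM2.Λ' := ⟨PartrecToTM2.trNormal c .halt⟩
  obtain ⟨Λ, _, _, M, hM⟩ := exists_finite_machine_of_supports <| TM1to0.tr_supports _ <|
    TM2to1.tr_supports PartrecToTM2.tr <| PartrecToTM2.tr_supports c .halt
  refine ⟨_, Λ, inferInstance, _, inferInstance, ‹_›, M, mainStackLetter true .cons,
    mainStackDigit, fun n => ?_⟩
  have eval_code : c.eval [n] = (fun m => [m]) <$> f n := hc ⟨[n], rfl⟩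
  rw [hM, TM1to0.tr_eval, ← trInit_trList_singleton]
  refine (TM2to1.tr_eval_dom PartrecToTM2.tr _ _).trans ?_
  unfold TM2.eval
  rw [init_main_eq, PartrecToTM2.tr_eval, eval_code]
  rfl

theorem exists_turingMachine_halting_undecidable :
    ∃ (Γ Λ : Type) (_ : Inhabited Γ) (_ : Inhabited Λ) (_ : Finite Γ) (_ : Finite Λ)
      (M : TM0.Machine Γ Λ) (a : Γ) (digit : Bool → Γ),
      ¬ ComputablePred fun n => (TM0.eval M (binaryWord a digit n)).Dom := by
  have universal_partrec : Partrec fun n => (Denumerable.ofNat Nat.Partrec.Code n).eval 0 :=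
    Nat.Partrec.Code.eval_part.comp (Computable.ofNat _) (Computable.const 0)
  obtain ⟨Γ, Λ, _, _, _, _, M, a, digit, hM⟩ := exists_turingMachine_of_partrec universal_partrec
  refine ⟨Γ, Λ, ‹_›, ‹_›, ‹_›, ‹_›, M, a, digit, fun h => ComputablePred.halting_problem 0 ?_⟩
  refine ComputablePred.computable_of_manyOneReducible
    ⟨Encodable.encode, Computable.encode, fun c => ?_⟩ h
  rw [hM, Denumerable.ofNat_encode]

/-! ### A1CAs with an arbitrary type of states -/

/-- A unary A1CA whose states are taken from an arbitrary type, of which only finitely many occur in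
the lists. It can be described to an algorithm by replacing the states by their numerical codes. -/
structure A1CAPresentation (S : Type*) where
  universal : List S
  transitions : List ((S × Option Unit × Bool) × (S × SignType))
  initial : S
  accepting : S

namespace A1CAPresentation

variable {S : Type*}

/-- The description in which each state is named by its numerical code. -/
def toCode [Encodable S] (P : A1CAPresentation S) : UnaryA1CACode where
  states := []
  universal := P.universal.map Encodable.encode
  transitions := P.transitions.map
    (Prod.map (Prod.map Encodable.encode id) (Prod.map Encodable.encode id))
  initial := Encodable.encode P.initial
  accepting := Encodable.encode P.accepting

/-- The truth value of a node of the computation tree, as in `A1CA.value`, but for states whose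
type need not be finite. -/
def Holds (P : A1CAPresentation S) : List (Option Unit) → S → ℤ → Prop
  | [], s, _ => s = P.accepting
  | x :: xs, s, c =>
    (s ∈ P.universal ∧ (∃ p, ((s, x, decide (c = 0)), p) ∈ P.transitions) ∧
      ∀ p, ((s, x, decide (c = 0)), p) ∈ P.transitions → P.Holds xs p.1 (c + (p.2 : ℤ))) ∨
    (s ∉ P.universal ∧
      ∃ p, ((s, x, decide (c = 0)), p) ∈ P.transitions ∧ P.Holds xs p.1 (c + (p.2 : ℤ)))

section

variable {P : A1CAPresentation S} {x : Option Unit} {xs : List (Option Unit)} {s : S} {c : ℤ}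

theorem holds_cons_of_mem_universal (hs : s ∈ P.universal) :
    P.Holds (x :: xs) s c ↔ (∃ p, ((s, x, decide (c = 0)), p) ∈ P.transitions) ∧
      ∀ p, ((s, x, decide (c = 0)), p) ∈ P.transitions → P.Holds xs p.1 (c + (p.2 : ℤ)) := by
  simp only [Holds, hs, true_and, not_true_eq_false, false_and, or_false]

theorem holds_cons_of_notMem_universal (hs : s ∉ P.universal) :
    P.Holds (x :: xs) s c ↔
      ∃ p, ((s, x, decide (c = 0)), p) ∈ P.transitions ∧ P.Holds xs p.1 (c + (p.2 : ℤ)) := by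
  simp only [Holds, hs, false_and, not_false_eq_true, true_and, false_or]

end

section

variable [Encodable S] {P : A1CAPresentation S}

theorem encode_mem_universal_toCode {s : S} :
    Encodable.encode s ∈ P.toCode.universal ↔ s ∈ P.universal :=
  List.mem_map_of_injective Encodable.encode_injective

theorem mem_transitions_toCode {s : S} {x : Option Unit} {z : Bool} {r : ℕ × SignType} :
    ((Encodable.encode s, x, z), r) ∈ P.toCode.transitions ↔
      ∃ p, ((s, x, z), p) ∈ P.transitions ∧ (Encodable.encode p.1, p.2) = r := by
  rw [toCode, List.mem_map]
  constructor
  · rintro ⟨⟨⟨s', x', z'⟩, p⟩, h, hr⟩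
    obtain ⟨⟨hs, rfl, rfl⟩, hp⟩ : (Encodable.encode s' = Encodable.encode s ∧ x' = x ∧ z' = z) ∧
        (Encodable.encode p.1, p.2) = r := by
      simpa only [Prod.map, id, Prod.mk.injEq] using hr
    exact ⟨p, Encodable.encode_injective hs ▸ h, hp⟩
  · rintro ⟨p, h, rfl⟩
    exact ⟨_, h, rfl⟩

theorem encode_mem_stateSet_toCode {r : S × Option Unit × Bool} {p : S × SignType}
    (h : (r, p) ∈ P.transitions) : Encodable.encode p.1 ∈ P.toCode.stateSet := by
  have h' : ((Encodable.encode r.1, r.2), (Encodable.encode p.1, p.2)) ∈ P.toCode.transitions :=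
    mem_transitions_toCode.2 ⟨p, h, rfl⟩
  simp only [UnaryA1CACode.stateSet, List.mem_toFinset, List.mem_cons, List.mem_append,
    List.mem_flatMap]
  exact Or.inr (Or.inr (Or.inr ⟨_, h', by simp⟩))

theorem value_toCode_iff_holds (xs : List (Option Unit)) (s : S)
    (hs : Encodable.encode s ∈ P.toCode.stateSet) (c : ℤ) :
    P.toCode.toA1CA.value xs ⟨Encodable.encode s, hs⟩ c ↔ P.Holds xs s c := by
  induction xs generalizing s c with
  | nil => exact Subtype.ext_iff.trans Encodable.encode_inj
  | cons x xs ih =>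
    have mem_δ : ∀ q : P.toCode.stateSet × SignType,
        q ∈ P.toCode.toA1CA.δ ⟨Encodable.encode s, hs⟩ x (decide (c = 0)) ↔
          ∃ p, ∃ h : ((s, x, decide (c = 0)), p) ∈ P.transitions,
            (⟨Encodable.encode p.1, encode_mem_stateSet_toCode h⟩, p.2) = q := fun q => by
      simp only [UnaryA1CACode.toA1CA, Set.mem_ofPred_eq, mem_transitions_toCode, Prod.ext_iff,
        Subtype.ext_iff, exists_prop]
    have universal_iff : P.toCode.toA1CA.isUniversal ⟨Encodable.encode s, hs⟩ ↔ s ∈ P.universal :=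
      encode_mem_universal_toCode
    rw [A1CA.value, Holds, universal_iff]
    refine or_congr (and_congr_right' (and_congr ?_ ?_)) (and_congr_right' ?_)
    · simp only [Set.Nonempty, mem_δ]
      exact ⟨fun ⟨_, p, h, _⟩ => ⟨p, h⟩, fun ⟨p, h⟩ => ⟨_, p, h, rfl⟩⟩
    · simp only [mem_δ, forall_exists_index]
      exact ⟨fun H p h => (ih _ _ _).1 (H _ p h rfl), by
        rintro H _ p h rfl
        exact (ih _ _ _).2 (H p h)⟩
    · simp only [mem_δ]
      constructor
      · rintro ⟨_, ⟨p, h, rfl⟩, hp⟩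
        exact ⟨p, h, (ih _ _ _).1 hp⟩
      · rintro ⟨p, h, hp⟩
        exact ⟨_, ⟨p, h, rfl⟩, (ih _ _ _).2 hp⟩

theorem mem_language_toCode {w : List Unit} :
    w ∈ P.toCode.toA1CA.language ↔ P.Holds (A1CA.schedule w) P.initial 0 :=
  value_toCode_iff_holds _ _ _ _

end

theorem primrec_toCode {α : Type*} [Primcodable α] [Primcodable S] {P : α → A1CAPresentation S}
    (universal : Primrec fun x => (P x).universal)
    (transitions : Primrec fun x => (P x).transitions)
    (initial : Primrec fun x => (P x).initial) (accepting : Primrec fun x => (P x).accepting) :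
    Primrec fun x => (P x).toCode := by
  have primrec_rename : Primrec
      (Prod.map (Prod.map Encodable.encode id) (Prod.map Encodable.encode id) :
        (S × Option Unit × Bool) × (S × SignType) → _) :=
    (((Primrec.encode.comp (Primrec.fst.comp Primrec.fst)).pair
      (Primrec.snd.comp Primrec.fst)).pair
      ((Primrec.encode.comp (Primrec.fst.comp Primrec.snd)).pair (Primrec.snd.comp Primrec.snd)))
  exact (Primrec.of_equiv_symm (e := UnaryA1CACode.equivTuple)).comp <|
    (Primrec.const []).pair <|
    (Primrec.list_map universal (Primrec.encode.comp Primrec.snd).to₂).pair <|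
    (Primrec.list_map transitions (primrec_rename.comp Primrec.snd).to₂).pair <|
    (Primrec.encode.comp initial).pair (Primrec.encode.comp accepting)

end A1CAPresentation

/-! ### Evaluation of cellular automata by A1CAs -/

theorem primrec_list_product {α β γ : Type*} [Primcodable α] [Primcodable β] [Primcodable γ]
    {l : α → List β} {m : α → List γ} (hl : Primrec l) (hm : Primrec m) :
    Primrec fun x => l x ×ˢ m x :=
  Primrec.list_flatMap hl <| Primrec.to₂ <| Primrec.list_map (hm.comp Primrec.fst) <|
    Primrec.to₂ <| (Primrec.snd.comp Primrec.fst).pair Primrec.snd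

/-- A one-dimensional cellular automaton with cell states `Q`: the local rule maps the states of the
left neighbour of a cell, of the cell and of its right neighbour to the next state of the cell. -/
abbrev CellularAutomaton (Q : Type*) := Q × Q × Q → Q

namespace CellularAutomaton

variable {Q : Type*}

/-- One step of the cellular automaton on a bi-infinite configuration. -/
def step (f : CellularAutomaton Q) (g : ℤ → Q) (c : ℤ) : Q := f (g (c - 1), g c, g (c + 1))

/-- The configuration with the state `origin` in cell `0` and the state `blank` elsewhere. -/
def singleCell (origin blank : Q) (c : ℤ) : Q := if c = 0 then origin else blank

/-- The states of an A1CA that evaluates a cellular automaton backwards in time, where the counter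
holds the position of a cell: a claim about the state of this cell, a claim about the states of its
neighbourhood, or a state for the end-markers. -/
inductive ControlState (Q : Type*)
  | claim (q : Q)
  | neighbourhood (t : Q × Q × Q)
  | start
  | ready
  | accept

namespace ControlState

/-- The control states as a sum type, which provides their numerical codes. -/
def equivSum : ControlState Q ≃ Q ⊕ (Q × Q × Q) ⊕ Fin 3 where
  toFun
    | claim q => .inl q
    | neighbourhood t => .inr (.inl t)
    | start => .inr (.inr 0)
    | ready => .inr (.inr 1)
    | accept => .inr (.inr 2)
  invFun
    | .inl q => claim q
    | .inr (.inl t) => neighbourhood t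
    | .inr (.inr 0) => start
    | .inr (.inr 1) => ready
    | .inr (.inr 2) => accept
  left_inv s := by cases s <;> rfl
  right_inv := by
    rintro (q | t | i)
    · rfl
    · rfl
    · fin_cases i <;> rfl

variable [Primcodable Q]

instance : Primcodable (ControlState Q) := Primcodable.ofEquiv _ equivSum

theorem primrec_claim : Primrec (claim (Q := Q)) :=
  (Primrec.of_equiv_symm (e := equivSum)).comp Primrec.sumInl

theorem primrec_neighbourhood : Primrec (neighbourhood (Q := Q)) :=
  (Primrec.of_equiv_symm (e := equivSum)).comp (Primrec.sumInr.comp Primrec.sumInl)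

end ControlState

open ControlState A1CAPresentation

/-- A transition of an A1CA with the control states of the cellular automaton. -/
abbrev ControlTransition (Q : Type*) :=
  (ControlState Q × Option Unit × Bool) × (ControlState Q × SignType)

/-- The transitions on letters for a triple `t` of cell states: a claim about a cell is reduced to
the claim that the neighbourhood of this cell had the states `t` one step earlier, and this claim is
reduced to the claims about the three cells. -/
def letterTransitions (f : CellularAutomaton Q) (z : Bool) (t : Q × Q × Q) :
    List (ControlTransition Q) :=
  [((claim (f t), some (), z), (neighbourhood t, 0)),
    ((neighbourhood t, some (), z), (claim t.1, -1)),
    ((neighbourhood t, some (), z), (claim t.2.1, 0)),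
    ((neighbourhood t, some (), z), (claim t.2.2, 1))]

/-- The transitions on the end-markers: at the first one, cell `0` is claimed to have the state
`goal`; at the last one, a claim is compared with the initial configuration. -/
def markerTransitions (origin blank goal : Q) : List (ControlTransition Q) :=
  [((start, none, true), (ready, 0)),
    ((ready, none, true), (claim goal, 0)),
    ((claim origin, none, true), (accept, 0)),
    ((claim blank, none, false), (accept, 0)),
    ((accept, none, true), (accept, 0)),
    ((accept, none, false), (accept, 0))]

/-- The A1CA that accepts the words `w` such that cell `0` has the state `goal` after `w.length`
steps of the cellular automaton `f`, if all cell states that occur are listed in `cells`. -/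
def evaluator (f : CellularAutomaton Q) (cells : List Q) (origin blank goal : Q) :
    A1CAPresentation (ControlState Q) where
  universal := (cells ×ˢ cells ×ˢ cells).map neighbourhood
  transitions := markerTransitions origin blank goal ++
    (cells ×ˢ cells ×ˢ cells).flatMap fun t =>
      letterTransitions f true t ++ letterTransitions f false t
  initial := start
  accepting := accept

section

variable {f : CellularAutomaton Q} {cells : List Q} {origin blank goal : Q}

theorem mem_universal_evaluator {s : ControlState Q} :
    s ∈ (evaluator f cells origin blank goal).universal ↔
      ∃ t ∈ cells ×ˢ cells ×ˢ cells, neighbourhood t = s := by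
  rw [evaluator, List.mem_map]

theorem mem_transitions_evaluator_none {s : ControlState Q} {z : Bool}
    {p : ControlState Q × SignType} :
    ((s, none, z), p) ∈ (evaluator f cells origin blank goal).transitions ↔
      ((s, none, z), p) ∈ markerTransitions origin blank goal := by
  simp [evaluator, letterTransitions]

theorem mem_transitions_evaluator_some {s : ControlState Q} {z : Bool}
    {p : ControlState Q × SignType} :
    ((s, some (), z), p) ∈ (evaluator f cells origin blank goal).transitions ↔
      ∃ t ∈ cells ×ˢ cells ×ˢ cells, ((s, some (), z), p) ∈ letterTransitions f z t := by
  cases z <;> simp [evaluator, letterTransitions, markerTransitions]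

theorem holds_neighbourhood {t : Q × Q × Q} (ht : t ∈ cells ×ˢ cells ×ˢ cells)
    (xs : List (Option Unit)) (c : ℤ) :
    (evaluator f cells origin blank goal).Holds (some () :: xs) (neighbourhood t) c ↔
      (evaluator f cells origin blank goal).Holds xs (claim t.1) (c - 1) ∧
      (evaluator f cells origin blank goal).Holds xs (claim t.2.1) c ∧
      (evaluator f cells origin blank goal).Holds xs (claim t.2.2) (c + 1) := by
  have mem_transitions : ∀ p, ((neighbourhood t, some (), decide (c = 0)), p) ∈
      (evaluator f cells origin blank goal).transitions ↔
        p = (claim t.1, -1) ∨ p = (claim t.2.1, 0) ∨ p = (claim t.2.2, 1) := by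
    intro p
    rw [mem_transitions_evaluator_some]
    constructor
    · rintro ⟨t', -, h⟩
      simp only [letterTransitions, List.mem_cons, Prod.mk.injEq, reduceCtorEq, false_and,
        neighbourhood.injEq, and_true, List.not_mem_nil, or_false, false_or] at h
      rcases h with ⟨rfl, h⟩ | ⟨rfl, h⟩ | ⟨rfl, h⟩ <;> simp only [h, true_or, or_true]
    · exact fun h => ⟨t, ht, by simpa [letterTransitions] using h⟩
  rw [holds_cons_of_mem_universal (mem_universal_evaluator.2 ⟨t, ht, rfl⟩)]
  simp [mem_transitions, sub_eq_add_neg]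

theorem holds_claim_letter (xs : List (Option Unit)) (q : Q) (c : ℤ) :
    (evaluator f cells origin blank goal).Holds (some () :: some () :: xs) (claim q) c ↔
      ∃ t ∈ cells ×ˢ cells ×ˢ cells, f t = q ∧
        (evaluator f cells origin blank goal).Holds xs (claim t.1) (c - 1) ∧
        (evaluator f cells origin blank goal).Holds xs (claim t.2.1) c ∧
        (evaluator f cells origin blank goal).Holds xs (claim t.2.2) (c + 1) := by
  rw [holds_cons_of_notMem_universal (by simp [mem_universal_evaluator])]
  constructor
  · rintro ⟨p, hp, h⟩
    obtain ⟨t, ht, htp⟩ := mem_transitions_evaluator_some.1 hp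
    obtain ⟨rfl, rfl⟩ : q = f t ∧ p = (neighbourhood t, 0) := by
      simpa [letterTransitions] using htp
    exact ⟨t, ht, rfl, (holds_neighbourhood ht xs c).1 (by simpa using h)⟩
  · rintro ⟨t, ht, rfl, h⟩
    refine ⟨(neighbourhood t, 0),
      mem_transitions_evaluator_some.2 ⟨t, ht, by simp [letterTransitions]⟩, ?_⟩
    simpa using (holds_neighbourhood ht xs c).2 h

theorem holds_claim_marker (q : Q) (c : ℤ) :
    (evaluator f cells origin blank goal).Holds [none, none] (claim q) c ↔
      singleCell origin blank c = q := by
  have accepting_eq : (evaluator f cells origin blank goal).accepting = accept := rfl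
  rw [eq_comm]
  by_cases hc : c = 0 <;>
    simp [Holds, mem_transitions_evaluator_none, mem_universal_evaluator, markerTransitions, hc,
      accepting_eq, singleCell]

theorem holds_start (xs : List (Option Unit)) :
    (evaluator f cells origin blank goal).Holds (none :: none :: xs) start 0 ↔
      (evaluator f cells origin blank goal).Holds xs (claim goal) 0 := by
  simp [Holds, mem_transitions_evaluator_none, mem_universal_evaluator, markerTransitions]

theorem iterate_step_mem {g : ℤ → Q} (hf : ∀ t ∈ cells ×ˢ cells ×ˢ cells, f t ∈ cells)
    (hg : ∀ c, g c ∈ cells) (n : ℕ) (c : ℤ) : f.step^[n] g c ∈ cells := by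
  induction n generalizing c with
  | zero => exact hg c
  | succ n ih =>
    rw [Function.iterate_succ_apply']
    exact hf _ (by simp only [List.mem_product, ih, and_self])

theorem holds_claim (ho : origin ∈ cells) (hb : blank ∈ cells)
    (hf : ∀ t ∈ cells ×ˢ cells ×ˢ cells, f t ∈ cells) (w : List Unit) (q : Q) (c : ℤ) :
    (evaluator f cells origin blank goal).Holds ((w.map some ++ [none]).flatMap fun x => [x, x])
        (claim q) c ↔ f.step^[w.length] (singleCell origin blank) c = q := by
  induction w generalizing q c with
  | nil => exact holds_claim_marker q c
  | cons u w ih =>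
    simp only [List.map_cons, List.cons_append, List.flatMap_cons, List.nil_append]
    refine (holds_claim_letter _ q c).trans ?_
    simp only [ih, List.length_cons, Function.iterate_succ_apply']
    constructor
    · rintro ⟨t, -, rfl, hl, hm, hr⟩
      rw [step, hl, hm, hr]
    · rintro rfl
      have mem_cells : ∀ c, f.step^[w.length] (singleCell origin blank) c ∈ cells :=
        iterate_step_mem hf (fun c => by unfold singleCell; split_ifs <;> assumption) w.length
      exact ⟨_, by simp only [List.mem_product, mem_cells, and_self], rfl, rfl, rfl, rfl⟩

theorem mem_language_evaluator [Primcodable Q] (ho : origin ∈ cells) (hb : blank ∈ cells)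
    (hf : ∀ t ∈ cells ×ˢ cells ×ˢ cells, f t ∈ cells) (w : List Unit) :
    w ∈ (evaluator f cells origin blank goal).toCode.toA1CA.language ↔
      f.step^[w.length] (singleCell origin blank) 0 = goal :=
  mem_language_toCode.trans <| (holds_start _).trans <| holds_claim ho hb hf w goal 0

theorem language_evaluator_eq_zero_iff [Primcodable Q] (ho : origin ∈ cells) (hb : blank ∈ cells)
    (hf : ∀ t ∈ cells ×ˢ cells ×ˢ cells, f t ∈ cells) :
    (evaluator f cells origin blank goal).toCode.toA1CA.language = 0 ↔
      ¬ ∃ n, f.step^[n] (singleCell origin blank) 0 = goal := by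
  refine Set.eq_empty_iff_forall_notMem.trans ?_
  rw [not_exists]
  constructor
  · intro h n hn
    exact h (.replicate n ()) ((mem_language_evaluator ho hb hf _).2 (by simpa using hn))
  · exact fun h w hw => h _ ((mem_language_evaluator ho hb hf w).1 hw)

end

theorem primrec_letterTransitions [Primcodable Q] {f : CellularAutomaton Q} (hf : Primrec f)
    (z : Bool) : Primrec (letterTransitions f z) := by
  have claim_transition {g : Q × Q × Q → Q} (hg : Primrec g) (k : SignType) : Primrec fun t =>
      (((neighbourhood t, some (), z), (claim (g t), k)) : ControlTransition Q) :=
    (primrec_neighbourhood.pair (Primrec.const _)).pair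
      ((primrec_claim.comp hg).pair (Primrec.const _))
  have neighbourhood_transition : Primrec fun t =>
      (((claim (f t), some (), z), (neighbourhood t, 0)) : ControlTransition Q) :=
    ((primrec_claim.comp hf).pair (Primrec.const _)).pair
      (primrec_neighbourhood.pair (Primrec.const _))
  exact Primrec.list_cons.comp neighbourhood_transition <|
    Primrec.list_cons.comp (claim_transition Primrec.fst _) <|
    Primrec.list_cons.comp (claim_transition (Primrec.fst.comp Primrec.snd) _) <|
    Primrec.list_cons.comp (claim_transition (Primrec.snd.comp Primrec.snd) _) (Primrec.const _)

theorem primrec_markerTransitions [Primcodable Q] (blank goal : Q) :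
    Primrec fun origin => markerTransitions origin blank goal := by
  have origin_transition : Primrec fun origin : Q =>
      (((claim origin, none, true), (accept, 0)) : ControlTransition Q) :=
    (primrec_claim.pair (Primrec.const _)).pair (Primrec.const _)
  exact Primrec.list_cons.comp (Primrec.const _) <| Primrec.list_cons.comp (Primrec.const _) <|
    Primrec.list_cons.comp origin_transition (Primrec.const _)

theorem primrec_toCode_evaluator {α : Type*} [Primcodable α] [Primcodable Q]
    {f : CellularAutomaton Q} (hf : Primrec f) {cells : α → List Q} (hc : Primrec cells)
    {origin : α → Q} (ho : Primrec origin) (blank goal : Q) :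
    Primrec fun x => (evaluator f (cells x) (origin x) blank goal).toCode := by
  have triples : Primrec fun x => cells x ×ˢ cells x ×ˢ cells x :=
    primrec_list_product hc (primrec_list_product hc hc)
  refine primrec_toCode ?_ ?_ (Primrec.const _) (Primrec.const _)
  · exact Primrec.list_map triples (primrec_neighbourhood.comp Primrec.snd).to₂
  · exact Primrec.list_append.comp ((primrec_markerTransitions blank goal).comp ho) <|
      Primrec.list_flatMap triples <| Primrec.to₂ <| Primrec.list_append.comp
        ((primrec_letterTransitions hf true).comp Primrec.snd)
        ((primrec_letterTransitions hf false).comp Primrec.snd)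

end CellularAutomaton

/-! ### Simulation of Turing machines by cellular automata -/

/-- A cell of a cellular automaton that simulates a Turing machine: a tape symbol, together with the
state of the machine if the head is there. The value `none` signals that the machine has halted. -/
abbrev TapeCell (Γ Λ : Type*) := Option (Γ × Option Λ)

section TapeCells

variable {Γ Λ : Type*} [Inhabited Γ]

/-- The cells that represent a configuration of a Turing machine with the head in cell `p`. -/
def tapeCells (C : TM0.Cfg Γ Λ) (p c : ℤ) : TapeCell Γ Λ :=
  some (C.Tape.nth (c - p), if c = p then some C.q else none)

theorem tapeCells_self (C : TM0.Cfg Γ Λ) (p : ℤ) :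
    tapeCells C p p = some (C.Tape.nth 0, some C.q) := by
  rw [tapeCells, sub_self, if_pos rfl]

theorem tapeCells_of_ne (C : TM0.Cfg Γ Λ) {p c : ℤ} (h : c ≠ p) :
    tapeCells C p c = some (C.Tape.nth (c - p), none) := by
  rw [tapeCells, if_neg h]

end TapeCells

section Simulation

variable {Γ Λ : Type*} [Inhabited Λ] (M : TM0.Machine Γ Λ)

/-- The state in which the head of the machine leaves a cell in the given direction, if it does. -/
def departing (d : Dir) : TapeCell Γ Λ → Option Λ
  | some (a, some q) =>
    match M q a with
    | some (q', .move d') => if d' = d then some q' else none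
    | _ => none
  | _ => none

/-- The cellular automaton that simulates one step of a Turing machine in each of its steps and
spreads the halting signal. -/
def tapeRule : CellularAutomaton (TapeCell Γ Λ)
  | (some _, some (a, some q), some _) =>
    match M q a with
    | none => none
    | some (_, .move _) => some (a, none)
    | some (q', .write b) => some (b, some q')
  | (some l, some (a, none), some r) =>
    some (a, (departing M .right (some l)).or (departing M .left (some r)))
  | _ => none

theorem tapeRule_none_left (x r : TapeCell Γ Λ) : tapeRule M (none, x, r) = none := by
  rcases x with _ | ⟨a, _ | q⟩ <;> cases r <;> rfl

theorem tapeRule_none_middle (l r : TapeCell Γ Λ) : tapeRule M (l, none, r) = none := by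
  cases l <;> cases r <;> rfl

theorem tapeRule_none_right (l x : TapeCell Γ Λ) : tapeRule M (l, x, none) = none := by
  rcases x with _ | ⟨a, _ | q⟩ <;> cases l <;> rfl

theorem iterate_step_tapeRule_eq_none {g : ℤ → TapeCell Γ Λ} {p : ℤ} (h : g p = none) {t : ℕ}
    {c : ℤ} (hc : (c - p).natAbs ≤ t) : (tapeRule M).step^[t] g c = none := by
  induction t generalizing c with
  | zero =>
    obtain rfl : c = p := by omega
    exact h
  | succ t ih =>
    rw [Function.iterate_succ_apply', CellularAutomaton.step]
    rcases lt_trichotomy c p with hlt | rfl | hlt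
    · rw [ih (c := c + 1) (by omega), tapeRule_none_right]
    · rw [ih (c := c) (by omega), tapeRule_none_middle]
    · rw [ih (c := c - 1) (by omega), tapeRule_none_left]

variable [Inhabited Γ]

variable {M}

theorem departing_tapeCells_of_ne (C : TM0.Cfg Γ Λ) {p c : ℤ} (h : c ≠ p) (d : Dir) :
    departing M d (tapeCells C p c) = none := by
  rw [tapeCells_of_ne C h]
  rfl

theorem step_tapeCells_of_ne (C : TM0.Cfg Γ Λ) {p c : ℤ} (h : c ≠ p) :
    (tapeRule M).step (tapeCells C p) c = some (C.Tape.nth (c - p),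
      (departing M .right (tapeCells C p (c - 1))).or
        (departing M .left (tapeCells C p (c + 1)))) := by
  rw [CellularAutomaton.step, tapeCells_of_ne C h]
  rfl

theorem step_tapeCells_of_write {C : TM0.Cfg Γ Λ} {q : Λ} {b : Γ}
    (h : M C.q (C.Tape.nth 0) = some (q, .write b)) (p : ℤ) :
    (tapeRule M).step (tapeCells C p) = tapeCells ⟨q, C.Tape.write b⟩ p := by
  have departing_eq_none (d : Dir) (c : ℤ) : departing M d (tapeCells C p c) = none := by
    rcases eq_or_ne c p with rfl | hc
    · simp only [tapeCells_self, departing, h]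
    · exact departing_tapeCells_of_ne C hc d
  funext c
  rcases eq_or_ne c p with rfl | hc
  · rw [CellularAutomaton.step, tapeCells_self, tapeCells_self, Tape.write_nth, if_pos rfl]
    simp only [tapeCells, tapeRule, h]
  · rw [step_tapeCells_of_ne C hc, tapeCells_of_ne _ hc, Tape.write_nth,
      if_neg (sub_ne_zero.2 hc), departing_eq_none, departing_eq_none, Option.or_none]

/-- The displacement of the head of a Turing machine in a step in the given direction. -/
def displacement : Dir → ℤ
  | .left => -1
  | .right => 1

theorem nth_move (T : Tape Γ) (d : Dir) (i : ℤ) :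
    (T.move d).nth i = T.nth (i + displacement d) := by
  cases d
  · exact T.move_left_nth i
  · exact T.move_right_nth i

theorem step_tapeCells_of_move {C : TM0.Cfg Γ Λ} {q : Λ} {d : Dir}
    (h : M C.q (C.Tape.nth 0) = some (q, .move d)) (p : ℤ) :
    (tapeRule M).step (tapeCells C p) = tapeCells ⟨q, C.Tape.move d⟩ (p + displacement d) := by
  have departing_eq (e : Dir) (c : ℤ) :
      departing M e (tapeCells C p c) = if c = p ∧ d = e then some q else none := by
    rcases eq_or_ne c p with rfl | hc
    · simp only [tapeCells_self, departing, h, true_and]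
    · rw [departing_tapeCells_of_ne C hc, if_neg (fun H => hc H.1)]
  funext c
  have nth_eq : (C.Tape.move d).nth (c - (p + displacement d)) = C.Tape.nth (c - p) := by
    rw [nth_move, sub_add_eq_sub_sub, sub_add_cancel]
  rw [tapeCells, nth_eq]
  rcases eq_or_ne c p with rfl | hc
  · have : c ≠ c + displacement d := by cases d <;> simp [displacement]
    rw [if_neg this, CellularAutomaton.step, tapeCells_self, sub_self]
    simp only [tapeCells, tapeRule, h]
  · rw [step_tapeCells_of_ne C hc, departing_eq, departing_eq]
    congr 2
    cases d
    · simp only [displacement, reduceCtorEq, and_false, and_true, if_false, Option.none_or]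
      exact if_congr (by omega) rfl rfl
    · simp only [displacement, reduceCtorEq, and_false, and_true, if_false, Option.or_none]
      exact if_congr (by omega) rfl rfl

theorem exists_step_tapeCells_eq {C C' : TM0.Cfg Γ Λ} (h : TM0.step M C = some C') (p : ℤ) :
    ∃ p', (tapeRule M).step (tapeCells C p) = tapeCells C' p' := by
  obtain ⟨⟨q, d | b⟩, hM, rfl⟩ := Option.map_eq_some_iff.1 h
  · exact ⟨_, step_tapeCells_of_move hM p⟩
  · exact ⟨_, step_tapeCells_of_write hM p⟩

theorem step_tapeCells_of_halt {C : TM0.Cfg Γ Λ} (h : TM0.step M C = none) (p : ℤ) :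
    (tapeRule M).step (tapeCells C p) p = none := by
  have hM : M C.q (C.Tape.nth 0) = none := Option.map_eq_none_iff.1 h
  rw [CellularAutomaton.step, tapeCells_self]
  simp only [tapeCells, tapeRule, hM]

theorem exists_iterate_step_tapeCells_eq_none_iff (C : TM0.Cfg Γ Λ) (p c : ℤ) :
    (∃ t, (tapeRule M).step^[t] (tapeCells C p) c = none) ↔
      (StateTransition.eval (TM0.step M) C).Dom := by
  constructor
  · rintro ⟨t, ht⟩
    induction t generalizing C p with
    | zero => exact absurd ht (Option.some_ne_none _)
    | succ t ih =>
      cases hC : TM0.step M C with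
      | none => exact Part.dom_iff_mem.2 ⟨C, StateTransition.mem_eval.2 ⟨.refl, hC⟩⟩
      | some C' =>
        obtain ⟨p', hp'⟩ := exists_step_tapeCells_eq hC p
        rw [Function.iterate_succ_apply, hp'] at ht
        rw [StateTransition.reaches_eval (.single hC)]
        exact ih C' p' ht
  · intro hC
    obtain ⟨C', hC'⟩ := Part.dom_iff_mem.1 hC
    obtain ⟨reaches, halt⟩ := StateTransition.mem_eval.1 hC'
    clear hC hC'
    induction reaches using Relation.ReflTransGen.head_induction_on generalizing p with
    | refl =>
      refine ⟨(c - p).natAbs + 1, ?_⟩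
      rw [Function.iterate_succ_apply]
      exact iterate_step_tapeRule_eq_none M (step_tapeCells_of_halt halt p) le_rfl
    | head h _ ih =>
      obtain ⟨p', hp'⟩ := exists_step_tapeCells_eq h p
      obtain ⟨t, ht⟩ := ih p'
      exact ⟨t + 1, by rwa [Function.iterate_succ_apply, hp']⟩

end Simulation

/-! ### Loading the input of a Turing machine -/

section Loading

theorem mk₁_cons {Γ : Type*} [Inhabited Γ] (x : Γ) (v : List Γ) :
    Tape.mk₁ (x :: v) = ((Tape.mk₁ v).move .left).write x := by
  simp only [Tape.mk₁, Tape.mk₂, Tape.move_left_mk', Tape.write_mk']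
  rfl

theorem nth_mk₁_cons {Γ : Type*} [Inhabited Γ] (x : Γ) (v : List Γ) (i : ℤ) :
    (Tape.mk₁ (x :: v)).nth i = if i = 0 then x else (Tape.mk₁ v).nth (i - 1) := by
  rw [mk₁_cons, Tape.write_nth, Tape.move_left_nth]

theorem nth_mk₁_nil {Γ : Type*} [Inhabited Γ] (i : ℤ) :
    (Tape.mk₁ ([] : List Γ)).nth i = default := by
  rcases i with (_ | i) | i <;> rfl

/-- A cell of a cellular automaton that writes the input of a Turing machine before it simulates the
machine: an ordinary cell, or a cell `Sum.inr k` at which the binary digits of the number `k` are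
still to be written. -/
abbrev LoadCell (Γ Λ : Type*) := TapeCell Γ Λ ⊕ ℕ

variable {Γ Λ : Type*} [Inhabited Γ]

/-- The content of a cell for the simulation of a Turing machine, where the cells that have not been
written yet count as blank. -/
def visible : LoadCell Γ Λ → TapeCell Γ Λ
  | .inl x => x
  | .inr _ => some (default, none)

/-- The configuration in which the word `v` has been written to the right of cell `p`, where the
number `k` is still to be written. -/
def loadCells (k : ℕ) (v : List Γ) (p c : ℤ) : LoadCell Γ Λ :=
  if c = p then .inr k else .inl (some ((Tape.mk₁ v).nth (c - p - 1), none))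

theorem loadCells_of_ne (k : ℕ) (v : List Γ) {p c : ℤ} (h : c ≠ p) :
    loadCells (Λ := Λ) k v p c = .inl (some ((Tape.mk₁ v).nth (c - p - 1), none)) := if_neg h

theorem exists_visible_loadCells_eq (k : ℕ) (v : List Γ) (p c : ℤ) :
    ∃ b, visible (loadCells (Λ := Λ) k v p c) = some (b, none) := by
  unfold loadCells
  split_ifs <;> exact ⟨_, rfl⟩

theorem singleCell_eq_loadCells (k : ℕ) :
    CellularAutomaton.singleCell (.inr k) (.inl (some (default, none))) =
      loadCells (Γ := Γ) (Λ := Λ) k [] 0 := by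
  funext c
  rw [loadCells, nth_mk₁_nil, CellularAutomaton.singleCell]

theorem loadCells_ne_inl_none (k : ℕ) (v : List Γ) (p c : ℤ) :
    loadCells (Λ := Λ) k v p c ≠ .inl none := by
  unfold loadCells
  split_ifs <;> simp

variable [Inhabited Λ]

/-- The cellular automaton that writes an input on a blank tape, from right to left, and then
simulates a Turing machine on it. A cell `Sum.inr k` writes the last binary digit of `k` and passes
the other digits on to its left neighbour; the cell `Sum.inr 0` writes the first letter `a` and
starts the machine. -/
def loadRule (M : TM0.Machine Γ Λ) (a : Γ) (digit : Bool → Γ) :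
    CellularAutomaton (LoadCell Γ Λ)
  | (_, .inr 0, _) => .inl (some (a, some default))
  | (_, .inr (k + 1), _) => .inl (some (digit (k + 1).bodd, none))
  | (_, .inl _, .inr (k + 1)) => .inr (k + 1).div2
  | (l, .inl x, r) => .inl (tapeRule M (visible l, x, visible r))

variable {M : TM0.Machine Γ Λ} {a : Γ} {digit : Bool → Γ}

theorem tapeRule_visible_loadCells (k : ℕ) (v : List Γ) (p c : ℤ) (b : Γ) :
    tapeRule M (visible (loadCells k v p (c - 1)), some (b, none),
      visible (loadCells k v p (c + 1))) = some (b, none) := by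
  obtain ⟨l, hl⟩ := exists_visible_loadCells_eq (Λ := Λ) k v p (c - 1)
  obtain ⟨r, hr⟩ := exists_visible_loadCells_eq (Λ := Λ) k v p (c + 1)
  rw [hl, hr]
  rfl

theorem loadRule_visible {l r : LoadCell Γ Λ} (x : TapeCell Γ Λ)
    (hr : ∀ k, r ≠ .inr (k + 1)) :
    loadRule M a digit (l, .inl x, r) = .inl (tapeRule M (visible l, x, visible r)) := by
  rcases r with r | _ | k
  · rfl
  · rfl
  · exact absurd rfl (hr k)

theorem step_loadCells_zero (v : List Γ) (p : ℤ) :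
    (loadRule M a digit).step (loadCells 0 v p) = Sum.inl ∘ tapeCells (TM0.init (a :: v)) p := by
  funext c
  rw [CellularAutomaton.step, Function.comp_apply, tapeCells, TM0.init, nth_mk₁_cons]
  rcases eq_or_ne c p with rfl | hc
  · rw [if_pos rfl, if_pos (sub_self c)]
    simp only [loadCells, if_true]
    rfl
  · have right_ne (k : ℕ) : loadCells (Λ := Λ) 0 v p (c + 1) ≠ .inr (k + 1) := by
      unfold loadCells
      split_ifs <;> simp
    rw [loadCells_of_ne 0 v hc, loadRule_visible _ right_ne, tapeRule_visible_loadCells,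
      if_neg hc, if_neg (sub_ne_zero.2 hc)]

theorem step_loadCells_of_ne_zero {k : ℕ} (hk : k ≠ 0) (v : List Γ) (p : ℤ) :
    (loadRule M a digit).step (loadCells k v p) =
      loadCells k.div2 (digit k.bodd :: v) (p - 1) := by
  obtain ⟨k, rfl⟩ := Nat.exists_eq_succ_of_ne_zero hk
  funext c
  rw [CellularAutomaton.step]
  rcases eq_or_ne c p with rfl | hc
  · rw [loadCells_of_ne _ _ (by omega : c ≠ c - 1), nth_mk₁_cons, if_pos (by omega)]
    simp only [loadCells, if_true]
    rfl
  rw [loadCells_of_ne _ _ hc]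
  rcases eq_or_ne c (p - 1) with rfl | hc'
  · simp only [loadCells, sub_add_cancel, if_true]
    rfl
  · have right_ne (j : ℕ) : loadCells (Λ := Λ) (k + 1) v p (c + 1) ≠ .inr (j + 1) := by
      rw [loadCells_of_ne _ _ (by omega)]
      exact Sum.inl_ne_inr
    rw [loadRule_visible _ right_ne, tapeRule_visible_loadCells, loadCells_of_ne _ _ hc',
      nth_mk₁_cons, if_neg (by omega)]
    congr 4
    omega

theorem iterate_step_inl (g : ℤ → TapeCell Γ Λ) (t : ℕ) :
    (loadRule M a digit).step^[t] (Sum.inl ∘ g) = Sum.inl ∘ (tapeRule M).step^[t] g :=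
  (Function.Semiconj.iterate_right (f := (Sum.inl ∘ ·)) (fun _ => rfl) t g).symm

theorem exists_iterate_iff_exists_iterate_apply {α β : Type*} {F : (α → β) → α → β} {g : α → β}
    {x : α} {y : β} (h : g x ≠ y) : (∃ t, F^[t] g x = y) ↔ ∃ t, F^[t] (F g) x = y := by
  rw [← Nat.or_exists_add_one]
  exact or_iff_right h

theorem exists_iterate_step_loadCells_iff (k : ℕ) (v : List Γ) (p c : ℤ) :
    (∃ t, (loadRule M a digit).step^[t] (loadCells k v p) c = .inl none) ↔
      (TM0.eval M (binaryWord a digit k ++ v)).Dom := by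
  induction k using Nat.binaryRec' generalizing v p with
  | zero =>
    rw [exists_iterate_iff_exists_iterate_apply (loadCells_ne_inl_none 0 v p c),
      step_loadCells_zero]
    simp only [iterate_step_inl, Function.comp_apply, Sum.inl.injEq]
    exact exists_iterate_step_tapeCells_eq_none_iff _ p c
  | bit b n h ih =>
    rw [exists_iterate_iff_exists_iterate_apply (loadCells_ne_inl_none _ v p c),
      step_loadCells_of_ne_zero (Nat.bit_ne_zero_iff.2 h), Nat.bodd_bit, Nat.div2_bit]
    refine (ih (digit b :: v) (p - 1)).trans ?_
    simp only [binaryWord, Nat.bits_append_bit n b h, List.map_cons, List.reverse_cons,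
      List.cons_append, List.append_assoc, List.nil_append]

theorem primrec_loadRule [Primcodable Γ] [Primcodable Λ] [Finite Γ] [Finite Λ]
    (M : TM0.Machine Γ Λ) (a : Γ) (digit : Bool → Γ) : Primrec (loadRule M a digit) := by
  have primrec_visible : Primrec (visible (Γ := Γ) (Λ := Λ)) :=
    (Primrec.sumCasesOn Primrec.id Primrec₂.right (Primrec.const (some (default, none))).to₂).of_eq
      fun x => by cases x <;> rfl
  have written : Primrec fun k : ℕ => (Nat.casesOn k (.inl (some (a, some default)))
      fun k => .inl (some (digit (k + 1).bodd, none)) : LoadCell Γ Λ) :=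
    Primrec.nat_casesOn Primrec.id (Primrec.const _) <| Primrec.to₂ <| Primrec.sumInl.comp <|
      (Primrec.dom_finite fun b => some (digit b, none)).comp <|
      Primrec.nat_bodd.comp (Primrec.succ.comp Primrec.snd)
  have simulated : Primrec fun t : (LoadCell Γ Λ × LoadCell Γ Λ × LoadCell Γ Λ) × TapeCell Γ Λ =>
      (.inl (tapeRule M (visible t.1.1, t.2, visible t.1.2.2)) : LoadCell Γ Λ) :=
    Primrec.sumInl.comp <| (Primrec.dom_finite (tapeRule M)).comp <|
      (primrec_visible.comp (Primrec.fst.comp Primrec.fst)).pair <| Primrec.snd.pair <|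
      primrec_visible.comp (Primrec.snd.comp (Primrec.snd.comp Primrec.fst))
  have unwritten : Primrec fun t : (LoadCell Γ Λ × LoadCell Γ Λ × LoadCell Γ Λ) × TapeCell Γ Λ =>
      (Sum.casesOn t.1.2.2 (fun _ => .inl (tapeRule M (visible t.1.1, t.2, visible t.1.2.2)))
        fun k => Nat.casesOn k (.inl (tapeRule M (visible t.1.1, t.2, visible t.1.2.2)))
          fun k => .inr (k + 1).div2 : LoadCell Γ Λ) :=
    Primrec.sumCasesOn (Primrec.snd.comp (Primrec.snd.comp Primrec.fst))
      (simulated.comp Primrec.fst).to₂ <| Primrec.to₂ <|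
      Primrec.nat_casesOn Primrec.snd (simulated.comp Primrec.fst) <| Primrec.to₂ <|
      Primrec.sumInr.comp <| Primrec.nat_div2.comp <| Primrec.succ.comp Primrec.snd
  refine (Primrec.sumCasesOn (Primrec.fst.comp Primrec.snd) unwritten.to₂
    (written.comp Primrec.snd).to₂).of_eq ?_
  rintro ⟨l, x | _ | k, r | _ | j⟩ <;> rfl

end Loading

theorem exists_primrec_language_eq_zero_iff {Γ Λ : Type*} [Inhabited Γ] [Inhabited Λ] [Finite Γ]
    [Finite Λ] (M : TM0.Machine Γ Λ) (a : Γ) (digit : Bool → Γ) :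
    ∃ F : ℕ → UnaryA1CACode, Primrec F ∧ ∀ n,
      (F n).toA1CA.language = 0 ↔ ¬ (TM0.eval M (binaryWord a digit n)).Dom := by
  let : Primcodable Γ := Primcodable.ofEquiv _ (Finite.equivFin Γ)
  let : Primcodable Λ := Primcodable.ofEquiv _ (Finite.equivFin Λ)
  obtain ⟨tapeList, -, mem_tapeList⟩ := Finite.exists_univ_list (TapeCell Γ Λ)
  let cells (n : ℕ) : List (LoadCell Γ Λ) :=
    tapeList.map Sum.inl ++ (List.range (n + 1)).map Sum.inr
  have primrec_cells : Primrec cells := Primrec.list_append.comp (Primrec.const _)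
    (Primrec.list_map (Primrec.list_range.comp Primrec.succ) (Primrec.sumInr.comp Primrec.snd).to₂)
  have inl_mem (n : ℕ) (x) : .inl x ∈ cells n := by simp [cells, mem_tapeList]
  have inr_mem (n k : ℕ) : .inr k ∈ cells n ↔ k ≤ n := by simp [cells]
  have loadRule_mem (n : ℕ) (t) (ht : t ∈ cells n ×ˢ cells n ×ˢ cells n) :
      loadRule M a digit t ∈ cells n := by
    obtain ⟨l, x | _ | k, r | _ | j⟩ := t <;> try exact inl_mem n _
    have hj : j + 1 ≤ n := by
      simp only [List.mem_product, inr_mem] at ht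
      exact ht.2.2
    exact (inr_mem n _).2 ((Nat.div_le_self _ 2).trans hj)
  refine ⟨fun n => ((loadRule M a digit).evaluator (cells n) (.inr n)
      (.inl (some (default, none))) (.inl none)).toCode,
    CellularAutomaton.primrec_toCode_evaluator (primrec_loadRule M a digit) primrec_cells
      Primrec.sumInr _ _, fun n => ?_⟩
  rw [CellularAutomaton.language_evaluator_eq_zero_iff ((inr_mem n n).2 le_rfl) (inl_mem n _)
    (loadRule_mem n), singleCell_eq_loadCells, exists_iterate_step_loadCells_iff, List.append_nil]

/-- No algorithm decides, given a description of an alternating one-counter automaton over a unary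
alphabet, whether its language is empty (`0` is the empty language). -/
theorem theorem1 :
    ¬ ComputablePred (fun d : UnaryA1CACode => d.toA1CA.language = 0) := by
  intro emptiness
  obtain ⟨Γ, Λ, _, _, _, _, M, a, digit, halting_undecidable⟩ :=
    exists_turingMachine_halting_undecidable
  obtain ⟨F, primrec_F, language_eq_zero_iff⟩ := exists_primrec_language_eq_zero_iff M a digit
  have nonhalting : ComputablePred fun n => ¬ (TM0.eval M (binaryWord a digit n)).Dom :=
    ComputablePred.computable_of_manyOneReducible
      ⟨F, primrec_F.to_comp, fun n => (language_eq_zero_iff n).symm⟩ emptiness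
  exact halting_undecidable (nonhalting.not.of_eq fun n => not_not)
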